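/- For $n\ge 1$, a *standard $n$-puzzle* is a $2\times(n+1)$ array whose set of entries is exactly $\{1,2,\dots,2n+2\}$. Its *pieces* are the $n$ squares formed by two adjacent columns; the *reduction* of a piece is obtained by replacing its four labels by $1,2,3,4$ in the same relative order. For a set $\mathcal P$ of reduced pieces let $s_n(\mathcal P)$ be the number of standard $n$-puzzles all of whose pieces have their reduction in $\mathcal P$. Put $$A_2=\begin{bmatrix}3&4\\1&2\end{bmatrix},\quad A_3=\begin{bmatrix}2&4\\1&3\end{bmatrix},\quad \mathcal P=\{A_2,A_3\},$$ $$B_1=\begin{bmatrix}4&2\\1&3\end{bmatrix},\; B_2=\begin{bmatrix}3&2\\1&4\end{bmatrix},\; B_3=\begin{bmatrix}2&3\\1&4\end{bmatrix},\; B_4=\begin{bmatrix}3&1\\2&4\end{bmatrix},\; B_5=\begin{bmatrix}4&1\\2&3\end{bmatrix},\; B_6=\begin{bmatrix}4&1\\3&2\end{bmatrix}.$$ Let $C(n)=\frac1{n+2}\binom{2n+2}{n+1}$ (the Catalan numbers, indexed so that $C(0)=1$, $C(1)=2$, $C(2)=5$), and let $t(n,k)$, $0\le k\le n$, be Catalan's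 triangle: $t(0,0)=1$ and $t(n,k)=\sum_{j=0}^{k}t(n-1,j)$ for $n\ge1$, with $t(n-1,n)=0$. **Theorem.** For every $n\ge1$: - $s_n(\mathcal P\cup \{B_1\})=\dfrac{3}{n+3}\dbinom{2n+2}{n}$; - $s_n(\mathcal P\cup \{B_2\})=\dfrac{7n+2}{n^2+2n}\dbinom{2n}{n+1}$; - $s_n(\mathcal P\cup \{B_3\})=C(n)+C(n-1)$; - $s_n(\mathcal P\cup \{B_4\})=\dbinom{2n+1}{n}$; - $s_n(\mathcal P\cup \{B_5\})=\dfrac{8n(2n+1)}{(n+2)(n+3)}\dbinom{2n-1}{n}+\dfrac{2}{n+2}\dbinom{2n+2}{n+1}-\dbinom{2n+1}{n}$; - $s_n(\mathcal P\cup \{B_6\})=\dfrac{3\binom{2n-1}{n}\binom{2n+2}{3}}{(n+2)(n+3)}+\dfrac{1}{n+2}\dbinom{2n+2}{n+1}$. Moreover, as sums against Catalan's triangle, - $s_n(\mathcal P\cup \{B_1\})=\sum_{k=1}^{n-1}\binom{n-k+3}{3}t(n-2,k-1)+C(n)$ for $n\ge2$; - $s_n(\mathcal P\cup \{B_2\})=\sum_{k=1}^{n-1}\binom{n-k+2}{2}t(n-2,k-1)+C(n)$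 for $n\ge2$; - $s_n(\mathcal P\cup \{B_4\})=\sum_{k=1}^{n}(n+k-1)\,t(n-1,k-1)+C(n)$ for $n\ge1$; - $s_n(\mathcal P\cup \{B_5\})=\sum_{k=1}^{n}(n+k-1)(n-k+2)\,t(n-1,k-1)-\binom{2n+1}{n}+2C(n)$ for $n\ge1$; - $s_n(\mathcal P\cup \{B_6\})=\sum_{k=1}^{n}\binom{n+k}{2}t(n-1,k-1)+C(n)$ for $n\ge1$. -/

import Mathlib

namespace StandardPuzzle

/-- A `2 × (n + 1)` array (row `0` is the top row, row `1` the bottom row), that is, a row of `n`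
concatenated pieces, is a standard `n`-puzzle if the set of its labels is `{1, …, 2n + 2}`, where
`2n + 2` is the number of its vertices. -/
def IsStandardPuzzle (n : ℕ) (M : Matrix (Fin 2) (Fin (n + 1)) ℕ) : Prop :=
  Set.range (fun v : Fin 2 × Fin (n + 1) => M v.1 v.2) = Set.Icc 1 (2 * n + 2)

/-- The `k`-th piece of a puzzle: the square formed by two adjacent columns. -/
def pieceAt {n : ℕ} (M : Matrix (Fin 2) (Fin (n + 1)) ℕ) (k : Fin n) : Matrix (Fin 2) (Fin 2) ℕ :=
  !![M 0 k.castSucc, M 0 k.succ;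
     M 1 k.castSucc, M 1 k.succ]

/-- The reduction of a piece: every label is replaced by its rank among the labels of the piece,
so that four distinct labels become `1, 2, 3, 4` in the same relative order. -/
def reduction (p : Matrix (Fin 2) (Fin 2) ℕ) : Matrix (Fin 2) (Fin 2) ℕ :=
  fun i j => (Finset.univ.filter (fun v : Fin 2 × Fin 2 => p v.1 v.2 ≤ p i j)).card

/-- `P` is a support of the puzzle `M` if the reduction of each piece of `M` belongs to `P`. -/
def IsSupport {n : ℕ} (P : Set (Matrix (Fin 2) (Fin 2) ℕ))
    (M : Matrix (Fin 2) (Fin (n + 1)) ℕ) : Prop :=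
  ∀ k : Fin n, reduction (pieceAt M k) ∈ P

/-- The set `S_n(P)` of the standard `n`-puzzles with support `P`. -/
def S (n : ℕ) (P : Set (Matrix (Fin 2) (Fin 2) ℕ)) : Set (Matrix (Fin 2) (Fin (n + 1)) ℕ) :=
  {M | IsStandardPuzzle n M ∧ IsSupport P M}

/-- The number `s_n(P)` of standard `n`-puzzles with support `P`. -/
noncomputable def s (n : ℕ) (P : Set (Matrix (Fin 2) (Fin 2) ℕ)) : ℕ := (S n P).ncard

def A₂ : Matrix (Fin 2) (Fin 2) ℕ := !![3, 4; 1, 2]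
def A₃ : Matrix (Fin 2) (Fin 2) ℕ := !![2, 4; 1, 3]

def B₁ : Matrix (Fin 2) (Fin 2) ℕ := !![4, 2; 1, 3]
def B₂ : Matrix (Fin 2) (Fin 2) ℕ := !![3, 2; 1, 4]
def B₃ : Matrix (Fin 2) (Fin 2) ℕ := !![2, 3; 1, 4]
def B₄ : Matrix (Fin 2) (Fin 2) ℕ := !![3, 1; 2, 4]
def B₅ : Matrix (Fin 2) (Fin 2) ℕ := !![4, 1; 2, 3]
def B₆ : Matrix (Fin 2) (Fin 2) ℕ := !![4, 1; 3, 2]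

/-- Catalan's triangle `t(n, k)`, `0 ≤ k ≤ n`, extended by `0` to `k > n`. -/
def t : ℕ → ℕ → ℕ
  | 0, k => if k = 0 then 1 else 0
  | n + 1, k => if k ≤ n + 1 then ∑ j ∈ Finset.range (k + 1), t n j else 0

end StandardPuzzle

/-!
In a puzzle over `{A₂, A₃} ∪ {Bᵢ}` every piece has its left column increasing from bottom to top,
whereas `Bᵢ` has its right column decreasing, so `Bᵢ` can only occur as the last piece. The puzzles
with support `{A₂, A₃}` whose last column increases are the standard Young tableaux of shape
`2 × (n + 1)`, and Catalan's triangle counts them by the label in their lower right corner: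
`t n k` of them have `n + 1 + k` there. Hence `sₙ₊₁` is the number of tableaux of shape
`2 × (n + 2)` plus a sum over `k` of `t n k` times the number of columns which can be appended to
form a piece `Bᵢ`. This number is a polynomial in `k` of degree at most two, and iterated
partial sums of the rows of Catalan's triangle evaluate the sum.
-/

namespace StandardPuzzle

open Finset

/-! ### Catalan's triangle -/

theorem t_succ_of_le {n k : ℕ} (h : k ≤ n + 1) :
    t (n + 1) k = ∑ j ∈ range (k + 1), t n j := if_pos h

theorem t_eq_zero_of_lt {n k : ℕ} (h : n < k) : t n k = 0 := by
  cases n <;> exact if_neg (by omega)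

theorem t_zero_right (n : ℕ) : t n 0 = 1 := by
  induction n with
  | zero => rfl
  | succ n ih => rw [t_succ_of_le (Nat.zero_le _), sum_range_one, ih]

theorem t_succ_succ {n k : ℕ} (h : k ≤ n) : t (n + 1) (k + 1) = t (n + 1) k + t n (k + 1) := by
  rw [t_succ_of_le (by omega), t_succ_of_le (by omega), sum_range_succ _ (k + 1)]

theorem succ_mul_t (n k : ℕ) : (n + 1) * t n k = (n + 1 - k) * (n + k).choose k := by
  rcases lt_or_ge n k with hnk | hkn
  · rw [t_eq_zero_of_lt hnk, Nat.sub_eq_zero_of_le hnk, mul_zero, zero_mul]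
  induction n generalizing k with
  | zero => simp [Nat.le_zero.mp hkn, t]
  | succ n ihn =>
    induction k with
    | zero => simp [t_zero_right]
    | succ k ihk =>
      have left := ihk (by omega)
      have above : (n + 1) * t n (k + 1) = (n - k) * (n + 1 + k).choose (k + 1) := by
        rcases hkn.eq_or_lt with h | h
        · rw [t_eq_zero_of_lt (by omega), Nat.sub_eq_zero_of_le (by omega), mul_zero, zero_mul]
        · rw [ihn (k + 1) (by omega), Nat.add_sub_add_right, add_right_comm, add_assoc]
      have absorb := Nat.choose_succ_right_eq (n + 1 + k) k
      rw [Nat.add_sub_cancel] at absorb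
      rw [t_succ_succ (by omega), ← add_assoc, Nat.choose_succ_succ,
        show n + 1 + 1 - (k + 1) = n - k + 1 by omega]
      rw [show n + 1 + 1 - k = n - k + 2 by omega] at left
      obtain ⟨d, rfl⟩ := Nat.exists_eq_add_of_le (show k ≤ n by omega)
      rw [Nat.add_sub_cancel_left] at *
      refine Nat.eq_of_mul_eq_mul_left (Nat.succ_pos (k + d)) ?_
      zify at *
      linear_combination (k + d + 1 : ℤ) * left + (k + d + 2 : ℤ) * above - absorb

theorem t_self (n : ℕ) : t n n = catalan n := by
  refine Nat.eq_of_mul_eq_mul_left n.succ_pos ?_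
  rw [succ_mul_catalan_eq_centralBinom, succ_mul_t, Nat.add_sub_cancel_left, one_mul,
    Nat.centralBinom, two_mul]

theorem t_succ_self (n : ℕ) : t (n + 1) n = catalan (n + 1) := by
  rw [← t_self, t_succ_succ le_rfl, t_eq_zero_of_lt n.lt_succ_self, add_zero]

theorem sum_choose_mul_t (r : ℕ) {n k : ℕ} (hk : k ≤ n + 1) :
    ∑ j ∈ range (k + 1), (k - j + r).choose r * t n j = t (n + r + 1) k := by
  induction r generalizing k with
  | zero => simp [t_succ_of_le hk]
  | succ r ihr =>
    induction k with
    | zero => simp [t_zero_right]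
    | succ k ihk =>
      have pascal : ∀ j ∈ range (k + 1), (k + 1 - j + (r + 1)).choose (r + 1) * t n j =
          (k - j + (r + 1)).choose (r + 1) * t n j + (k + 1 - j + r).choose r * t n j := by
        intro j hj
        rw [mem_range] at hj
        rw [← add_mul, ← add_assoc, Nat.choose_succ_succ, add_comm (Nat.choose _ r),
          show k + 1 - j + r = k - j + (r + 1) by omega]
      have last := sum_range_succ (fun j => (k + 1 - j + r).choose r * t n j) (k + 1)
      rw [ihr hk] at last
      rw [sum_range_succ, sum_congr rfl pascal, sum_add_distrib, ihk (by omega), add_assoc,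
        show n + (r + 1) + 1 = n + r + 1 + 1 by ring, t_succ_succ (by omega), last]
      simp

theorem sum_range_mul_t_succ (n : ℕ) (w : ℕ → ℕ) :
    ∑ j ∈ range (n + 2), w j * t (n + 1) j =
      ∑ k ∈ range (n + 1), (∑ j ∈ Ico k (n + 2), w j) * t n k := by
  have extend : ∑ k ∈ range (n + 1), (∑ j ∈ Ico k (n + 2), w j) * t n k =
      ∑ k ∈ range (n + 2), (∑ j ∈ Ico k (n + 2), w j) * t n k := by
    rw [sum_range_succ _ (n + 1), t_eq_zero_of_lt n.lt_succ_self, mul_zero, add_zero]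
  rw [extend]
  simp only [range_eq_Ico, sum_mul]
  rw [sum_Ico_Ico_comm]
  refine sum_congr rfl fun j hj => ?_
  rw [mem_Ico] at hj
  rw [t_succ_of_le (by omega), mul_sum, range_eq_Ico]

/-- The functions `(m - k + r).choose r` for `r ≤ 2`, whose sums against `t m` are known, span the
polynomials in `k` of degree at most two. -/
theorem sum_mul_t_of_quadratic {m : ℕ} {w : ℕ → ℕ} {a b c : ℚ}
    (hw : ∀ k ≤ m, (w k : ℚ) = a + b * (m - k + 1) + c * ((m - k + 1) * (m - k + 2) / 2)) :
    ((∑ k ∈ range (m + 1), w k * t m k : ℕ) : ℚ) =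
      a * t (m + 1) m + b * t (m + 2) m + c * t (m + 3) m := by
  simp only [← sum_choose_mul_t 0 m.le_succ, ← sum_choose_mul_t 1 m.le_succ,
    ← sum_choose_mul_t 2 m.le_succ, Nat.cast_sum, Nat.cast_mul, mul_sum, ← sum_add_distrib]
  refine sum_congr rfl fun k hk => ?_
  have hkm : k ≤ m := by simpa [Nat.lt_succ_iff] using hk
  rw [hw k hkm, Nat.choose_zero_right, Nat.choose_one_right, Nat.cast_choose_two]
  push_cast [hkm]
  ring

theorem t_add_eq_factorial (m r : ℕ) :
    (t (m + r) m : ℚ) =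
      (r + 1) * (2 * m + r).factorial / (m.factorial * (m + r + 1).factorial) := by
  have h : ((m + r + 1) * t (m + r) m : ℚ) = (r + 1) * (m + (m + r)).choose m := by
    have := succ_mul_t (m + r) m
    rw [show m + r + 1 - m = r + 1 by omega, add_comm (m + r) m] at this
    exact_mod_cast this
  rw [Nat.cast_add_choose, ← add_assoc, ← two_mul] at h
  rw [Nat.factorial_succ, eq_div_iff (by positivity)]
  field_simp at h
  push_cast
  linear_combination h

theorem catalan_eq_factorial (n : ℕ) :
    (catalan n : ℚ) = (2 * n).factorial / (n.factorial * (n + 1).factorial) := by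
  simpa [t_self] using t_add_eq_factorial n 0

/-! ### Appending a column to a puzzle -/

/-- The increasing enumeration of the positive integers different from `a` and `b`, used to make
room for two new labels. -/
def skip (a b v : ℕ) : ℕ := if v < min a b then v else if v + 1 < max a b then v + 1 else v + 2

theorem strictMono_skip (a b : ℕ) : StrictMono (skip a b) := by
  intro v w h
  unfold skip
  split_ifs <;> omega

theorem skip_ne_left (a b v : ℕ) : skip a b v ≠ a := by
  unfold skip
  split_ifs <;> omega

theorem skip_ne_right (a b v : ℕ) : skip a b v ≠ b := by
  unfold skip
  split_ifs <;> omega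

theorem image_skip_Icc {a b N : ℕ} (hab : (a, b) ∈ (Icc 1 (N + 2)).offDiag) :
    skip a b '' Set.Icc 1 N = Set.Icc 1 (N + 2) \ {a, b} := by
  simp only [mem_offDiag, mem_Icc] at hab
  ext w
  constructor
  · rintro ⟨v, ⟨hv₁, hvN⟩, rfl⟩
    refine ⟨?_, by simp [skip_ne_left, skip_ne_right]⟩
    rw [Set.mem_Icc, skip]
    split_ifs <;> omega
  · rintro ⟨⟨hw₁, hwN⟩, hw⟩
    rw [Set.mem_insert_iff, Set.mem_singleton_iff, not_or] at hw
    refine ⟨if w < min a b then w else if w < max a b then w - 1 else w - 2, ?_, ?_⟩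
    · rw [Set.mem_Icc]
      split_ifs <;> omega
    · unfold skip
      split_ifs <;> omega

/-- The array obtained from `M` by appending a last column with top label `a` and bottom label `b`,
after shifting the labels of `M` to make room for `a` and `b`. -/
def appendColumn {n : ℕ} (M : Matrix (Fin 2) (Fin (n + 1)) ℕ) (a b : ℕ) :
    Matrix (Fin 2) (Fin (n + 2)) ℕ :=
  fun i => Fin.snoc (α := fun _ => ℕ) (fun j => skip a b (M i j)) (![a, b] i)

section appendColumn

variable {n : ℕ} {M : Matrix (Fin 2) (Fin (n + 1)) ℕ} {a b : ℕ}

@[simp] theorem appendColumn_castSucc (i : Fin 2) (j : Fin (n + 1)) :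
    appendColumn M a b i j.castSucc = skip a b (M i j) :=
  Fin.snoc_castSucc (α := fun _ => ℕ) ..

@[simp] theorem appendColumn_last (i : Fin 2) :
    appendColumn M a b i (Fin.last (n + 1)) = ![a, b] i :=
  Fin.snoc_last (α := fun _ => ℕ) ..

theorem appendColumn_injective {M' : Matrix (Fin 2) (Fin (n + 1)) ℕ} {a' b' : ℕ}
    (h : appendColumn M a b = appendColumn M' a' b') : M = M' ∧ a = a' ∧ b = b' := by
  obtain rfl : a = a' := by simpa using congrFun (congrFun h 0) (Fin.last _)
  obtain rfl : b = b' := by simpa using congrFun (congrFun h 1) (Fin.last _)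
  refine ⟨Matrix.ext fun i j => (strictMono_skip a b).injective ?_, rfl, rfl⟩
  simpa using congrFun (congrFun h i) j.castSucc

theorem range_appendColumn :
    Set.range (fun v : Fin 2 × Fin (n + 2) => appendColumn M a b v.1 v.2) =
      skip a b '' Set.range (fun v : Fin 2 × Fin (n + 1) => M v.1 v.2) ∪ {a, b} := by
  ext w
  constructor
  · rintro ⟨⟨i, j⟩, rfl⟩
    induction j using Fin.lastCases with
    | last => fin_cases i <;> simp
    | cast j => exact Or.inl ⟨_, ⟨(i, j), rfl⟩, (appendColumn_castSucc i j).symm⟩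
  · rintro (⟨_, ⟨⟨i, j⟩, rfl⟩, rfl⟩ | rfl | rfl)
    · exact ⟨(i, j.castSucc), appendColumn_castSucc i j⟩
    · exact ⟨(0, Fin.last _), appendColumn_last 0⟩
    · exact ⟨(1, Fin.last _), appendColumn_last 1⟩

theorem isStandardPuzzle_appendColumn_iff (hab : (a, b) ∈ (Icc 1 (2 * n + 4)).offDiag) :
    IsStandardPuzzle (n + 1) (appendColumn M a b) ↔ IsStandardPuzzle n M := by
  have hsub : {a, b} ⊆ Set.Icc 1 (2 * (n + 1) + 2) := by
    simp only [mem_offDiag, mem_Icc] at hab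
    rintro v (rfl | rfl) <;> exact ⟨by omega, by omega⟩
  have hdisj : Disjoint (skip a b '' Set.range fun v : Fin 2 × Fin (n + 1) => M v.1 v.2)
      {a, b} := by
    rw [Set.disjoint_left]
    rintro _ ⟨v, -, rfl⟩
    simp [skip_ne_left, skip_ne_right]
  unfold IsStandardPuzzle
  rw [range_appendColumn,
    ← (strictMono_skip a b).injective.image_injective.eq_iff (b := Set.Icc 1 (2 * n + 2)),
    image_skip_Icc hab]
  constructor
  · intro h
    rw [← hdisj.sdiff_eq_left, ← Set.union_sdiff_right, h, mul_add_one]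
  · intro h
    rw [h]
    exact Set.sdiff_union_of_subset hsub

end appendColumn

section IsStandardPuzzle

variable {n : ℕ} {M : Matrix (Fin 2) (Fin (n + 1)) ℕ}

theorem IsStandardPuzzle.mem_Icc (h : IsStandardPuzzle n M) (i : Fin 2) (j : Fin (n + 1)) :
    M i j ∈ Set.Icc 1 (2 * n + 2) :=
  h ▸ Set.mem_range_self (i, j)

theorem IsStandardPuzzle.exists_eq (h : IsStandardPuzzle n M) {v : ℕ}
    (hv : v ∈ Set.Icc 1 (2 * n + 2)) : ∃ i j, M i j = v := by
  rw [← h] at hv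
  simpa using hv

theorem IsStandardPuzzle.injective (h : IsStandardPuzzle n M) :
    Function.Injective (fun v : Fin 2 × Fin (n + 1) => M v.1 v.2) := by
  have himage : univ.image (fun v : Fin 2 × Fin (n + 1) => M v.1 v.2) = Icc 1 (2 * n + 2) := by
    rw [← coe_inj, coe_image, coe_univ, Set.image_univ, coe_Icc]
    exact h
  have hcard : #(univ.image fun v : Fin 2 × Fin (n + 1) => M v.1 v.2) =
      #(univ : Finset (Fin 2 × Fin (n + 1))) := by
    rw [himage, Nat.card_Icc, card_univ, Fintype.card_prod, Fintype.card_fin, Fintype.card_fin,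
      Nat.add_sub_cancel, mul_add_one]
  simpa using card_image_iff.mp hcard

theorem IsStandardPuzzle.ne (h : IsStandardPuzzle n M) {i i' : Fin 2} {j j' : Fin (n + 1)}
    (hne : (i, j) ≠ (i', j')) : M i j ≠ M i' j' :=
  h.injective.ne hne

theorem finite_isStandardPuzzle (n : ℕ) : {M | IsStandardPuzzle n M}.Finite :=
  (Set.Finite.pi' fun _ => Set.Finite.pi' fun _ => Set.finite_Icc 1 (2 * n + 2)).subset
    fun _ hM i j => hM.mem_Icc i j

theorem IsStandardPuzzle.exists_appendColumn {M : Matrix (Fin 2) (Fin (n + 2)) ℕ}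
    (hM : IsStandardPuzzle (n + 1) M) :
    ∃ (M' : Matrix (Fin 2) (Fin (n + 1)) ℕ) (a b : ℕ), IsStandardPuzzle n M' ∧
      (a, b) ∈ (Icc 1 (2 * n + 4)).offDiag ∧ appendColumn M' a b = M := by
  set a := M 0 (Fin.last (n + 1)) with ha
  set b := M 1 (Fin.last (n + 1)) with hb
  have hab : (a, b) ∈ (Icc 1 (2 * n + 4)).offDiag := by
    simp only [mem_offDiag, Finset.mem_Icc]
    exact ⟨hM.mem_Icc _ _, hM.mem_Icc _ _, hM.ne (by simp)⟩
  have hpre : ∀ i (j : Fin (n + 1)), ∃ v, skip a b v = M i j.castSucc := by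
    intro i j
    have hmem : M i j.castSucc ∈ Set.Icc 1 (2 * n + 2 + 2) \ {a, b} :=
      ⟨hM.mem_Icc _ _, by simp [ha, hb, hM.ne, (Fin.castSucc_lt_last j).ne]⟩
    rw [← image_skip_Icc hab] at hmem
    obtain ⟨v, -, hv⟩ := hmem
    exact ⟨v, hv⟩
  obtain ⟨M', hM'⟩ : ∃ M' : Matrix (Fin 2) (Fin (n + 1)) ℕ,
      ∀ i j, skip a b (M' i j) = M i j.castSucc := by
    choose f hf using hpre
    exact ⟨f, hf⟩
  have happend : appendColumn M' a b = M := by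
    ext i j
    induction j using Fin.lastCases with
    | last => fin_cases i <;> simp [ha, hb]
    | cast j => simp [hM']
  exact ⟨M', a, b, (isStandardPuzzle_appendColumn_iff hab).mp (happend ▸ hM), hab, happend⟩

end IsStandardPuzzle

/-! ### Reductions of pieces -/

theorem lt_of_reduction_lt {p : Matrix (Fin 2) (Fin 2) ℕ} {i j i' j' : Fin 2}
    (h : reduction p i j < reduction p i' j') : p i j < p i' j' := by
  by_contra! hle
  refine h.not_ge (card_le_card fun v hv => ?_)
  simp only [mem_filter, mem_univ, true_and] at hv ⊢
  exact hv.trans hle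

theorem reduction_map {f : ℕ → ℕ} (hf : StrictMono f) (p : Matrix (Fin 2) (Fin 2) ℕ) :
    reduction (p.map f) = reduction p := by
  ext i j
  simp [reduction, hf.le_iff_le]

theorem reduction_eq_iff {B : Matrix (Fin 2) (Fin 2) ℕ} (hB : reduction B = B)
    (hinj : Function.Injective fun v : Fin 2 × Fin 2 => B v.1 v.2)
    {p : Matrix (Fin 2) (Fin 2) ℕ} :
    reduction p = B ↔ ∀ i j i' j', B i j < B i' j' → p i j < p i' j' := by
  constructor
  · rintro rfl i j i' j'
    exact lt_of_reduction_lt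
  · intro h
    have hle : ∀ i j i' j', p i j ≤ p i' j' ↔ B i j ≤ B i' j' := by
      intro i j i' j'
      refine ⟨fun hp => not_lt.mp fun hlt => (h _ _ _ _ hlt).not_ge hp, fun hb => ?_⟩
      rcases hb.lt_or_eq with hlt | heq
      · exact (h _ _ _ _ hlt).le
      · obtain ⟨rfl, rfl⟩ := Prod.mk.inj (hinj (a₁ := (i, j)) (a₂ := (i', j')) heq)
        exact le_rfl
    rw [← hB]
    ext i j
    simp only [reduction, hle]

section reduction

variable {p q r u : ℕ}

theorem reduction_mem_A_iff (h : p ≠ u) :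
    reduction !![p, q; r, u] ∈ ({A₂, A₃} : Set _) ↔ r < u ∧ u < q ∧ r < p ∧ p < q := by
  rw [Set.mem_insert_iff, Set.mem_singleton_iff, reduction_eq_iff (by decide) (by decide),
    reduction_eq_iff (by decide) (by decide)]
  simp only [Fin.forall_fin_two, A₂, A₃, Matrix.of_apply, Matrix.cons_val_zero, Matrix.cons_val_one]
  omega

theorem reduction_eq_B₁_iff : reduction !![p, q; r, u] = B₁ ↔ r < q ∧ q < u ∧ u < p := by
  rw [reduction_eq_iff (by decide) (by decide)]
  simp only [Fin.forall_fin_two, B₁, Matrix.of_apply, Matrix.cons_val_zero, Matrix.cons_val_one]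
  omega

theorem reduction_eq_B₂_iff : reduction !![p, q; r, u] = B₂ ↔ r < q ∧ q < p ∧ p < u := by
  rw [reduction_eq_iff (by decide) (by decide)]
  simp only [Fin.forall_fin_two, B₂, Matrix.of_apply, Matrix.cons_val_zero, Matrix.cons_val_one]
  omega

theorem reduction_eq_B₃_iff : reduction !![p, q; r, u] = B₃ ↔ r < p ∧ p < q ∧ q < u := by
  rw [reduction_eq_iff (by decide) (by decide)]
  simp only [Fin.forall_fin_two, B₃, Matrix.of_apply, Matrix.cons_val_zero, Matrix.cons_val_one]
  omega

theorem reduction_eq_B₄_iff : reduction !![p, q; r, u] = B₄ ↔ q < r ∧ r < p ∧ p < u := by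
  rw [reduction_eq_iff (by decide) (by decide)]
  simp only [Fin.forall_fin_two, B₄, Matrix.of_apply, Matrix.cons_val_zero, Matrix.cons_val_one]
  omega

theorem reduction_eq_B₅_iff : reduction !![p, q; r, u] = B₅ ↔ q < r ∧ r < u ∧ u < p := by
  rw [reduction_eq_iff (by decide) (by decide)]
  simp only [Fin.forall_fin_two, B₅, Matrix.of_apply, Matrix.cons_val_zero, Matrix.cons_val_one]
  omega

theorem reduction_eq_B₆_iff : reduction !![p, q; r, u] = B₆ ↔ q < u ∧ u < r ∧ r < p := by
  rw [reduction_eq_iff (by decide) (by decide)]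
  simp only [Fin.forall_fin_two, B₆, Matrix.of_apply, Matrix.cons_val_zero, Matrix.cons_val_one]
  omega

end reduction

section pieceAt

variable {n : ℕ} (M : Matrix (Fin 2) (Fin (n + 1)) ℕ) (a b : ℕ)

theorem pieceAt_appendColumn_castSucc (k : Fin n) :
    pieceAt (appendColumn M a b) k.castSucc = (pieceAt M k).map (skip a b) := by
  ext i j
  fin_cases i <;> fin_cases j <;> simp [pieceAt, Fin.succ_castSucc, -Fin.castSucc_succ]

theorem pieceAt_appendColumn_last :
    pieceAt (appendColumn M a b) (Fin.last n) =
      !![skip a b (M 0 (Fin.last n)), a; skip a b (M 1 (Fin.last n)), b] := by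
  simp [pieceAt]

theorem isSupport_appendColumn_iff (P : Set (Matrix (Fin 2) (Fin 2) ℕ)) :
    IsSupport P (appendColumn M a b) ↔
      IsSupport P M ∧ reduction (pieceAt (appendColumn M a b) (Fin.last n)) ∈ P := by
  simp only [IsSupport, Fin.forall_fin_succ', pieceAt_appendColumn_castSucc,
    reduction_map (strictMono_skip a b)]

end pieceAt

/-! ### Two-row tableaux -/

/-- A standard Young tableau of shape `2 × (n + 1)`, drawn with its larger row on top. -/
structure IsTableau {n : ℕ} (M : Matrix (Fin 2) (Fin (n + 1)) ℕ) : Prop where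
  isStandardPuzzle : IsStandardPuzzle n M
  row_strictMono (i : Fin 2) : StrictMono (M i)
  col_lt (j : Fin (n + 1)) : M 1 j < M 0 j

section IsTableau

variable {n : ℕ} {M : Matrix (Fin 2) (Fin (n + 1)) ℕ}

theorem isTableau_iff_isSupport (hM : IsStandardPuzzle n M) :
    IsTableau M ↔ IsSupport {A₂, A₃} M ∧ M 1 (Fin.last n) < M 0 (Fin.last n) := by
  have hpiece (k : Fin n) : reduction (pieceAt M k) ∈ ({A₂, A₃} : Set _) ↔
      M 1 k.castSucc < M 1 k.succ ∧ M 1 k.succ < M 0 k.succ ∧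
        M 1 k.castSucc < M 0 k.castSucc ∧ M 0 k.castSucc < M 0 k.succ :=
    reduction_mem_A_iff (hM.ne (by simp))
  simp only [IsSupport, hpiece]
  constructor
  · intro h
    exact ⟨fun k => ⟨h.row_strictMono 1 k.castSucc_lt_succ, h.col_lt _, h.col_lt _,
      h.row_strictMono 0 k.castSucc_lt_succ⟩, h.col_lt _⟩
  · rintro ⟨h, hlast⟩
    refine ⟨hM, fun i => Fin.strictMono_iff_lt_succ.mpr fun k => ?_, fun j => ?_⟩
    · fin_cases i
      exacts [(h k).2.2.2, (h k).1]
    · induction j using Fin.lastCases with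
      | last => exact hlast
      | cast k => exact (h k).2.2.1

theorem IsTableau.apply_zero_last (h : IsTableau M) : M 0 (Fin.last n) = 2 * n + 2 := by
  obtain ⟨i, j, hij⟩ := h.isStandardPuzzle.exists_eq ⟨Nat.le_add_left 1 (2 * n + 1), le_rfl⟩
  have hcorner : M i j ≤ M 0 (Fin.last n) := calc
    M i j ≤ M 0 j := by
      fin_cases i
      exacts [le_rfl, (h.col_lt j).le]
    _ ≤ M 0 (Fin.last n) := (h.row_strictMono 0).monotone j.le_last
  exact (h.isStandardPuzzle.mem_Icc 0 _).2.antisymm (hij ▸ hcorner)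

theorem IsTableau.apply_one_last_lt (h : IsTableau M) : M 1 (Fin.last n) < 2 * n + 2 :=
  h.apply_zero_last ▸ h.col_lt (Fin.last n)

theorem strictMono_appendColumn_iff {a b : ℕ} (i : Fin 2) :
    StrictMono (appendColumn M a b i) ↔
      StrictMono (M i) ∧ skip a b (M i (Fin.last n)) < ![a, b] i := by
  simp only [Fin.strictMono_iff_lt_succ, Fin.forall_fin_succ' (n := n), Fin.succ_castSucc,
    Fin.succ_last, appendColumn_castSucc, appendColumn_last, (strictMono_skip a b).lt_iff_lt]

theorem isTableau_appendColumn_iff {a b : ℕ} (hab : (a, b) ∈ (Icc 1 (2 * n + 4)).offDiag) :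
    IsTableau (appendColumn M a b) ↔
      IsTableau M ∧ a = 2 * n + 4 ∧ b ∈ Ioc (M 1 (Fin.last n)) (2 * n + 3) := by
  have hskip := strictMono_skip a b
  rw [mem_Ioc]
  constructor
  · intro h
    have ha : a = 2 * (n + 1) + 2 := by simpa using h.apply_zero_last
    have hb : b < 2 * (n + 1) + 2 := by simpa using h.apply_one_last_lt
    have hrow i := (strictMono_appendColumn_iff i).mp (h.row_strictMono i)
    have hcol j : M 1 j < M 0 j := hskip.lt_iff_lt.mp (by simpa using h.col_lt j.castSucc)
    refine ⟨⟨(isStandardPuzzle_appendColumn_iff hab).mp h.isStandardPuzzle,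
      fun i => (hrow i).1, hcol⟩, ha, ?_, Nat.lt_succ_iff.mp hb⟩
    exact (hskip.le_apply).trans_lt (hrow 1).2
  · rintro ⟨h, rfl, hb, hbn⟩
    have htop : skip (2 * n + 4) b (M 0 (Fin.last n)) < 2 * n + 4 := by
      rw [h.apply_zero_last, skip]
      split_ifs <;> omega
    have hbot : skip (2 * n + 4) b (M 1 (Fin.last n)) < b := by
      rw [skip]
      split_ifs <;> omega
    refine ⟨(isStandardPuzzle_appendColumn_iff hab).mpr h.isStandardPuzzle, fun i => ?_,
      fun j => ?_⟩
    · refine (strictMono_appendColumn_iff i).mpr ⟨h.row_strictMono i, ?_⟩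
      fin_cases i
      exacts [htop, hbot]
    · induction j using Fin.lastCases with
      | last => simpa using (by omega : b < 2 * n + 4)
      | cast j => simpa using hskip (h.col_lt j)

end IsTableau

/-- The finite set of standard Young tableaux of shape `2 × (n + 1)`. -/
noncomputable def tableaux (n : ℕ) : Finset (Matrix (Fin 2) (Fin (n + 1)) ℕ) :=
  ((finite_isStandardPuzzle n).subset fun _ => IsTableau.isStandardPuzzle).toFinset

theorem mem_tableaux {n : ℕ} {M : Matrix (Fin 2) (Fin (n + 1)) ℕ} :
    M ∈ tableaux n ↔ IsTableau M :=
  Set.Finite.mem_toFinset _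

theorem tableaux_zero : tableaux 0 = {!![2; 1]} := by
  ext M
  rw [mem_tableaux, mem_singleton]
  constructor
  · intro h
    have htop : M 0 0 = 2 := h.apply_zero_last
    have hbot : M 1 0 = 1 :=
      le_antisymm (Nat.lt_succ_iff.mp h.apply_one_last_lt) (h.isStandardPuzzle.mem_Icc 1 0).1
    ext i j
    fin_cases i <;> fin_cases j
    exacts [htop, hbot]
  · rintro rfl
    have hrange : Set.range (fun v : Fin 2 × Fin 1 => (!![2; 1] : Matrix _ _ ℕ) v.1 v.2) =
        Set.Icc 1 2 := by
      ext v
      simp only [Set.mem_range, Prod.exists, Fin.exists_fin_two, exists_const, Set.mem_Icc,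
        Matrix.of_apply, Matrix.cons_val', Matrix.cons_val_fin_one, Matrix.cons_val_zero,
        Matrix.cons_val_one]
      omega
    exact ⟨hrange, fun i => Subsingleton.strictMono (α := Fin 1) _, by simp⟩

theorem sum_tableaux_succ (n : ℕ) (f : ℕ → ℕ) :
    ∑ M ∈ tableaux (n + 1), f (M 1 (Fin.last (n + 1))) =
      ∑ M ∈ tableaux n, ∑ b ∈ Ioc (M 1 (Fin.last n)) (2 * n + 3), f b := by
  rw [← sum_sigma (tableaux n) (fun M => Ioc (M 1 (Fin.last n)) (2 * n + 3)) fun q => f q.2]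
  symm
  refine sum_nbij (fun q => appendColumn q.1 (2 * n + 4) q.2) ?_ ?_ ?_ ?_
  · rintro ⟨M, b⟩ hq
    rw [mem_sigma, mem_tableaux] at hq
    have hab : (2 * n + 4, b) ∈ (Icc 1 (2 * n + 4)).offDiag := by
      simp only [mem_offDiag, mem_Icc, mem_Ioc] at hq ⊢
      omega
    rw [mem_tableaux, isTableau_appendColumn_iff hab]
    exact ⟨hq.1, rfl, hq.2⟩
  · rintro ⟨M, b⟩ - ⟨M', b'⟩ - h
    obtain ⟨rfl, -, rfl⟩ := appendColumn_injective h
    rfl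
  · intro M hM
    rw [mem_coe, mem_tableaux] at hM
    obtain ⟨M', a, b, -, hab, rfl⟩ := hM.isStandardPuzzle.exists_appendColumn
    obtain ⟨h, rfl, hb⟩ := (isTableau_appendColumn_iff hab).mp hM
    exact ⟨⟨M', b⟩, by simpa [mem_tableaux] using ⟨h, mem_Ioc.mp hb⟩, rfl⟩
  · intro q _
    simp

theorem sum_tableaux (n : ℕ) (f : ℕ → ℕ) :
    ∑ M ∈ tableaux n, f (M 1 (Fin.last n)) = ∑ k ∈ range (n + 1), f (n + 1 + k) * t n k := by
  induction n generalizing f with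
  | zero => simp [tableaux_zero, t]
  | succ n ih =>
    rw [sum_tableaux_succ, ih fun x => ∑ b ∈ Ioc x (2 * n + 3), f b, sum_range_mul_t_succ]
    refine sum_congr rfl fun k _ => ?_
    rw [sum_Ico_add f k (n + 2) (n + 1 + 1)]
    congr 2
    ext b
    simp only [mem_Ioc, mem_Ico]
    omega

theorem card_tableaux (n : ℕ) : #(tableaux n) = catalan (n + 1) := by
  rw [card_eq_sum_ones, sum_tableaux n fun _ => 1, ← t_succ_self, t_succ_of_le n.le_succ]
  simp

/-! ### Puzzles with at most one exceptional piece -/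

open Classical in
/-- The columns, with top label `p.1` and bottom label `p.2`, that can be appended to the puzzle `M`
so that the new piece has its reduction in `𝓑`. -/
noncomputable def lastColumns {n : ℕ} (M : Matrix (Fin 2) (Fin (n + 1)) ℕ)
    (𝓑 : Set (Matrix (Fin 2) (Fin 2) ℕ)) : Finset (ℕ × ℕ) :=
  {p ∈ (Icc 1 (2 * n + 4)).offDiag |
    reduction (pieceAt (appendColumn M p.1 p.2) (Fin.last n)) ∈ 𝓑}

section lastColumns

variable {n : ℕ} {M : Matrix (Fin 2) (Fin (n + 1)) ℕ} {𝓑 : Set (Matrix (Fin 2) (Fin 2) ℕ)}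

theorem mem_lastColumns {p : ℕ × ℕ} :
    p ∈ lastColumns M 𝓑 ↔ p ∈ (Icc 1 (2 * n + 4)).offDiag ∧
      reduction (pieceAt (appendColumn M p.1 p.2) (Fin.last n)) ∈ 𝓑 := by
  classical exact mem_filter

theorem pieceAt_left_lt_of_isSupport (h𝓑 : ∀ B ∈ 𝓑, B 1 0 < B 0 0)
    (hM : IsSupport ({A₂, A₃} ∪ 𝓑) M) (k : Fin n) : M 1 k.castSucc < M 0 k.castSucc := by
  refine lt_of_reduction_lt (p := pieceAt M k) (i := 1) (j := 0) (i' := 0) (j' := 0) ?_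
  rcases hM k with (h | h) | h
  · rw [h]
    decide
  · rw [h]
    decide
  · exact h𝓑 _ h

/-- A piece with reduction in `𝓑` has its right column decreasing, whereas every allowed piece has
its left column increasing: so such a piece can only be the last one. -/
theorem isSupport_union_iff_of_lt (h𝓑 : ∀ B ∈ 𝓑, B 1 0 < B 0 0 ∧ B 0 1 < B 1 1)
    (hlast : M 1 (Fin.last n) < M 0 (Fin.last n)) :
    IsSupport ({A₂, A₃} ∪ 𝓑) M ↔ IsSupport {A₂, A₃} M := by
  refine ⟨fun h k => (h k).resolve_right fun hB => ?_, fun h k => Or.inl (h k)⟩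
  have hgt : M 0 k.succ < M 1 k.succ :=
    lt_of_reduction_lt (p := pieceAt M k) (i := 0) (j := 1) (i' := 1) (j' := 1) (h𝓑 _ hB).2
  have hlt : ∀ j, M 1 j < M 0 j :=
    Fin.lastCases hlast (pieceAt_left_lt_of_isSupport (fun B hB => (h𝓑 B hB).1) h)
  exact hgt.asymm (hlt _)

theorem isTableau_appendColumn_iff_reduction_mem (hM : IsStandardPuzzle n M) {a b : ℕ}
    (hab : (a, b) ∈ (Icc 1 (2 * n + 4)).offDiag) :
    IsTableau (appendColumn M a b) ↔
      IsTableau M ∧ reduction (pieceAt (appendColumn M a b) (Fin.last n)) ∈ ({A₂, A₃} : Set _) := by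
  rw [isTableau_iff_isSupport hM,
    isTableau_iff_isSupport ((isStandardPuzzle_appendColumn_iff hab).mpr hM),
    isSupport_appendColumn_iff, pieceAt_appendColumn_last,
    reduction_mem_A_iff (skip_ne_right a b _), (strictMono_skip a b).lt_iff_lt,
    appendColumn_last, appendColumn_last]
  simp only [Matrix.cons_val_zero, Matrix.cons_val_one]
  tauto

theorem appendColumn_mem_S_union_iff (h𝓑 : ∀ B ∈ 𝓑, B 1 0 < B 0 0 ∧ B 0 1 < B 1 1)
    (hM : IsStandardPuzzle n M) {a b : ℕ} (hab : (a, b) ∈ (Icc 1 (2 * n + 4)).offDiag) :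
    appendColumn M a b ∈ S (n + 1) ({A₂, A₃} ∪ 𝓑) ↔
      IsTableau (appendColumn M a b) ∨ IsTableau M ∧ (a, b) ∈ lastColumns M 𝓑 := by
  have hsupport (h : IsSupport ({A₂, A₃} ∪ 𝓑) (appendColumn M a b)) : IsTableau M := by
    have hlast : M 1 (Fin.last n) < M 0 (Fin.last n) := by
      simpa [(strictMono_skip a b).lt_iff_lt] using
        pieceAt_left_lt_of_isSupport (fun B hB => (h𝓑 B hB).1) h (Fin.last n)
    rw [isTableau_iff_isSupport hM, ← isSupport_union_iff_of_lt h𝓑 hlast]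
    exact ⟨((isSupport_appendColumn_iff M a b _).mp h).1, hlast⟩
  rw [isTableau_appendColumn_iff_reduction_mem hM hab, ← and_or_left, mem_lastColumns,
    and_iff_right hab]
  constructor
  · rintro ⟨-, h⟩
    exact ⟨hsupport h, h (Fin.last n)⟩
  · rintro ⟨hT, h⟩
    refine ⟨(isStandardPuzzle_appendColumn_iff hab).mpr hM,
      (isSupport_appendColumn_iff M a b _).mpr ⟨fun k => Or.inl ?_, h⟩⟩
    exact ((isTableau_iff_isSupport hM).mp hT).1 k

theorem not_isTableau_of_mem_lastColumns (h𝓑 : ∀ B ∈ 𝓑, B 0 1 < B 1 1) {p : ℕ × ℕ}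
    (hp : p ∈ lastColumns M 𝓑) : ¬ IsTableau (appendColumn M p.1 p.2) := by
  intro h
  have hgt : appendColumn M p.1 p.2 0 (Fin.last _) < appendColumn M p.1 p.2 1 (Fin.last _) :=
    lt_of_reduction_lt (p := pieceAt (appendColumn M p.1 p.2) (Fin.last n))
      (i := 0) (j := 1) (i' := 1) (j' := 1) (h𝓑 _ (mem_lastColumns.mp hp).2)
  exact hgt.asymm (h.col_lt _)

theorem S_succ_union (h𝓑 : ∀ B ∈ 𝓑, B 1 0 < B 0 0 ∧ B 0 1 < B 1 1) :
    S (n + 1) ({A₂, A₃} ∪ 𝓑) =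
      {M | ∃ M' a b, IsTableau M' ∧ (a, b) ∈ lastColumns M' 𝓑 ∧ appendColumn M' a b = M} ∪
        {M | IsTableau M} := by
  ext M
  constructor
  · intro hM
    obtain ⟨M', a, b, hM', hab, rfl⟩ := hM.1.exists_appendColumn
    rcases (appendColumn_mem_S_union_iff h𝓑 hM' hab).mp hM with h | ⟨hT, hlast⟩
    · exact Or.inr h
    · exact Or.inl ⟨M', a, b, hT, hlast, rfl⟩
  · rintro (⟨M', a, b, hT, hlast, rfl⟩ | hM)
    · exact (appendColumn_mem_S_union_iff h𝓑 hT.isStandardPuzzle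
        (mem_lastColumns.mp hlast).1).mpr (Or.inr ⟨hT, hlast⟩)
    · exact ⟨hM.isStandardPuzzle, fun k =>
        Or.inl (((isTableau_iff_isSupport hM.isStandardPuzzle).mp hM).1 k)⟩

end lastColumns

theorem s_succ_union (n : ℕ) {𝓑 : Set (Matrix (Fin 2) (Fin 2) ℕ)}
    (h𝓑 : ∀ B ∈ 𝓑, B 1 0 < B 0 0 ∧ B 0 1 < B 1 1) :
    s (n + 1) ({A₂, A₃} ∪ 𝓑) = ∑ M ∈ tableaux n, #(lastColumns M 𝓑) + catalan (n + 2) := by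
  classical
  set E := (tableaux n).sigma fun M => lastColumns M 𝓑
  set extend : (Σ _ : Matrix (Fin 2) (Fin (n + 1)) ℕ, ℕ × ℕ) → Matrix (Fin 2) (Fin (n + 2)) ℕ :=
    fun q => appendColumn q.1 q.2.1 q.2.2
  have hE (q) : q ∈ E ↔ IsTableau q.1 ∧ q.2 ∈ lastColumns q.1 𝓑 := by
    rw [mem_sigma, mem_tableaux]
  have hunion : S (n + 1) ({A₂, A₃} ∪ 𝓑) = ↑(E.image extend ∪ tableaux (n + 1)) := by
    ext M
    simp only [S_succ_union h𝓑, Set.mem_union, Set.mem_ofPred_eq, mem_coe, mem_union, mem_image,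
      mem_tableaux, hE, Sigma.exists, Prod.exists, and_assoc, extend]
  have hdisj : Disjoint (E.image extend) (tableaux (n + 1)) := by
    rw [Finset.disjoint_left]
    intro _ hM hT
    obtain ⟨q, hq, rfl⟩ := mem_image.mp hM
    exact not_isTableau_of_mem_lastColumns (fun B hB => (h𝓑 B hB).2) ((hE q).mp hq).2
      (mem_tableaux.mp hT)
  have hinj : Function.Injective extend := by
    rintro ⟨M, a, b⟩ ⟨M', a', b'⟩ h
    obtain ⟨rfl, rfl, rfl⟩ := appendColumn_injective h
    rfl
  rw [s, hunion, Set.ncard_coe_finset, card_union_of_disjoint hdisj, card_image_of_injective _ hinj,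
    card_sigma, card_tableaux]

section card_lastColumns

variable {n : ℕ} {M : Matrix (Fin 2) (Fin (n + 1)) ℕ}

theorem IsTableau.mem_lastColumns_singleton (hM : IsTableau M)
    {B : Matrix (Fin 2) (Fin 2) ℕ} {a b : ℕ} :
    (a, b) ∈ lastColumns M {B} ↔ (a, b) ∈ (Icc 1 (2 * n + 4)).offDiag ∧
      reduction !![skip a b (2 * n + 2), a; skip a b (M 1 (Fin.last n)), b] = B := by
  rw [mem_lastColumns, Set.mem_singleton_iff, pieceAt_appendColumn_last, hM.apply_zero_last]

theorem IsTableau.card_lastColumns_B₁ (hM : IsTableau M) :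
    #(lastColumns M {B₁}) = (2 * n + 3 - M 1 (Fin.last n)).choose 2 := by
  have hcolumns : lastColumns M {B₁} = {p ∈ Ioc (M 1 (Fin.last n)) (2 * n + 3) ×ˢ
      Ioc (M 1 (Fin.last n)) (2 * n + 3) | p.1 < p.2} := by
    ext ⟨a, b⟩
    rw [hM.mem_lastColumns_singleton, reduction_eq_B₁_iff, mem_filter, mem_product, mem_Ioc,
      mem_Ioc, mem_offDiag, mem_Icc, mem_Icc]
    unfold skip
    split_ifs <;> grind
  rw [hcolumns, card_product_filter_lt, Nat.card_Ioc]

theorem IsTableau.card_lastColumns_B₂ (hM : IsTableau M) :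
    #(lastColumns M {B₂}) = 2 * n + 2 - M 1 (Fin.last n) := by
  have hcolumns : lastColumns M {B₂} = Ioc (M 1 (Fin.last n)) (2 * n + 2) ×ˢ {2 * n + 4} := by
    ext ⟨a, b⟩
    rw [hM.mem_lastColumns_singleton, reduction_eq_B₂_iff, mem_product, mem_Ioc, mem_singleton,
      mem_offDiag, mem_Icc, mem_Icc]
    unfold skip
    split_ifs <;> grind
  rw [hcolumns, card_product, card_singleton, Nat.card_Ioc, mul_one]

theorem IsTableau.card_lastColumns_B₃ (hM : IsTableau M) : #(lastColumns M {B₃}) = 1 := by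
  have hx := hM.apply_one_last_lt
  have hcolumns : lastColumns M {B₃} = {(2 * n + 3, 2 * n + 4)} := by
    ext ⟨a, b⟩
    rw [hM.mem_lastColumns_singleton, reduction_eq_B₃_iff, mem_singleton, Prod.mk.injEq,
      mem_offDiag, mem_Icc, mem_Icc]
    unfold skip
    split_ifs <;> grind
  rw [hcolumns, card_singleton]

theorem IsTableau.card_lastColumns_B₄ (hM : IsTableau M) :
    #(lastColumns M {B₄}) = M 1 (Fin.last n) := by
  have hx := hM.apply_one_last_lt
  have hcolumns : lastColumns M {B₄} = Icc 1 (M 1 (Fin.last n)) ×ˢ {2 * n + 4} := by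
    ext ⟨a, b⟩
    rw [hM.mem_lastColumns_singleton, reduction_eq_B₄_iff, mem_product, mem_Icc, mem_singleton,
      mem_offDiag, mem_Icc, mem_Icc]
    unfold skip
    split_ifs <;> grind
  rw [hcolumns, card_product, card_singleton, Nat.card_Icc, mul_one, Nat.add_sub_cancel]

theorem IsTableau.card_lastColumns_B₅ (hM : IsTableau M) :
    #(lastColumns M {B₅}) = M 1 (Fin.last n) * (2 * n + 2 - M 1 (Fin.last n)) := by
  have hcolumns : lastColumns M {B₅} =
      Icc 1 (M 1 (Fin.last n)) ×ˢ Icc (M 1 (Fin.last n) + 2) (2 * n + 3) := by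
    ext ⟨a, b⟩
    rw [hM.mem_lastColumns_singleton, reduction_eq_B₅_iff, mem_product, mem_Icc, mem_Icc,
      mem_offDiag, mem_Icc, mem_Icc]
    unfold skip
    split_ifs <;> grind
  rw [hcolumns, card_product, Nat.card_Icc, Nat.card_Icc, Nat.add_sub_cancel,
    show 2 * n + 3 + 1 = 2 * n + 2 + 2 by rfl, Nat.add_sub_add_right]

theorem IsTableau.card_lastColumns_B₆ (hM : IsTableau M) :
    #(lastColumns M {B₆}) = (M 1 (Fin.last n) + 1).choose 2 := by
  have hx := hM.apply_one_last_lt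
  have hcolumns : lastColumns M {B₆} = {p ∈ Icc 1 (M 1 (Fin.last n) + 1) ×ˢ
      Icc 1 (M 1 (Fin.last n) + 1) | p.1 < p.2} := by
    ext ⟨a, b⟩
    rw [hM.mem_lastColumns_singleton, reduction_eq_B₆_iff, mem_filter, mem_product, mem_Icc,
      mem_Icc, mem_offDiag, mem_Icc, mem_Icc]
    unfold skip
    split_ifs <;> grind
  rw [hcolumns, card_product_filter_lt, Nat.card_Icc, Nat.add_sub_cancel]

end card_lastColumns

section s_succ

variable (n : ℕ)

theorem s_succ_union_singleton {B : Matrix (Fin 2) (Fin 2) ℕ}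
    (hB : B 1 0 < B 0 0 ∧ B 0 1 < B 1 1) {f : ℕ → ℕ}
    (hf : ∀ M : Matrix (Fin 2) (Fin (n + 1)) ℕ, IsTableau M →
      #(lastColumns M {B}) = f (M 1 (Fin.last n))) :
    s (n + 1) ({A₂, A₃} ∪ {B}) =
      ∑ k ∈ range (n + 1), f (n + 1 + k) * t n k + catalan (n + 2) := by
  rw [s_succ_union n (by simpa using hB), ← sum_tableaux]
  exact congrArg (· + _) (sum_congr rfl fun M hM => hf M (mem_tableaux.mp hM))

theorem s_succ_B₁ : s (n + 1) ({A₂, A₃} ∪ {B₁}) = t (n + 3) n + catalan (n + 2) := by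
  rw [s_succ_union_singleton n (by decide) (f := fun x => (2 * n + 3 - x).choose 2)
    fun _ => IsTableau.card_lastColumns_B₁, ← sum_choose_mul_t 2 n.le_succ]
  refine congrArg (· + _) (sum_congr rfl fun k hk => ?_)
  rw [mem_range] at hk
  rw [show 2 * n + 3 - (n + 1 + k) = n - k + 2 by omega]

theorem s_succ_B₂ : s (n + 1) ({A₂, A₃} ∪ {B₂}) = t (n + 2) n + catalan (n + 2) := by
  rw [s_succ_union_singleton n (by decide) (f := fun x => 2 * n + 2 - x)
    fun _ => IsTableau.card_lastColumns_B₂, ← sum_choose_mul_t 1 n.le_succ]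
  refine congrArg (· + _) (sum_congr rfl fun k hk => ?_)
  rw [mem_range] at hk
  rw [Nat.choose_one_right, show 2 * n + 2 - (n + 1 + k) = n - k + 1 by omega]

theorem s_succ_B₃ : s (n + 1) ({A₂, A₃} ∪ {B₃}) = catalan (n + 2) + catalan (n + 1) := by
  rw [s_succ_union_singleton n (by decide) (f := fun _ => 1)
    fun _ => IsTableau.card_lastColumns_B₃, ← t_succ_self n, t_succ_of_le n.le_succ, add_comm]
  simp only [one_mul]

theorem s_succ_B₄ : s (n + 1) ({A₂, A₃} ∪ {B₄}) =
    ∑ k ∈ range (n + 1), (n + 1 + k) * t n k + catalan (n + 2) :=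
  s_succ_union_singleton n (by decide) (f := fun x => x) fun _ => IsTableau.card_lastColumns_B₄

theorem s_succ_B₅ : s (n + 1) ({A₂, A₃} ∪ {B₅}) =
    ∑ k ∈ range (n + 1), (n + 1 + k) * (n - k + 1) * t n k + catalan (n + 2) := by
  rw [s_succ_union_singleton n (by decide) (f := fun x => x * (2 * n + 2 - x))
    fun _ => IsTableau.card_lastColumns_B₅]
  refine congrArg (· + _) (sum_congr rfl fun k hk => ?_)
  rw [mem_range] at hk
  rw [show 2 * n + 2 - (n + 1 + k) = n - k + 1 by omega]

theorem s_succ_B₆ : s (n + 1) ({A₂, A₃} ∪ {B₆}) =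
    ∑ k ∈ range (n + 1), (n + 1 + k + 1).choose 2 * t n k + catalan (n + 2) :=
  s_succ_union_singleton n (by decide) (f := fun x => (x + 1).choose 2)
    fun _ => IsTableau.card_lastColumns_B₆

end s_succ

/-! ### Closed forms and sums against Catalan's triangle -/

theorem cast_choose_of_eq_add {N k l : ℕ} (h : N = k + l) :
    (N.choose k : ℚ) = N.factorial / (k.factorial * l.factorial) := by
  rw [h, Nat.cast_add_choose]

theorem sum_Icc_one_eq_sum_range (N : ℕ) (f : ℕ → ℕ) :
    ∑ k ∈ Icc 1 N, f k = ∑ k ∈ range N, f (k + 1) := by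
  rw [range_eq_Ico, sum_Ico_add', zero_add, Ico_add_one_right_eq_Icc]

section count

variable {n : ℕ}

theorem s_B₁_eq_choose (hn : 1 ≤ n) :
    (s n ({A₂, A₃} ∪ {B₁}) : ℚ) = 3 / (n + 3) * (2 * n + 2).choose n := by
  obtain ⟨m, rfl⟩ := Nat.exists_eq_add_of_le' hn
  rw [s_succ_B₁, Nat.cast_add, t_add_eq_factorial m 3, catalan_eq_factorial,
    cast_choose_of_eq_add (l := m + 3) (by ring)]
  simp only [mul_add, Nat.reduceAdd, Nat.reduceMul, add_assoc, Nat.factorial_succ]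
  push_cast
  field_simp
  ring

theorem s_B₂_eq_choose (hn : 1 ≤ n) :
    (s n ({A₂, A₃} ∪ {B₂}) : ℚ) = (7 * n + 2) / (n ^ 2 + 2 * n) * (2 * n).choose (n + 1) := by
  obtain ⟨m, rfl⟩ := Nat.exists_eq_add_of_le' hn
  rw [s_succ_B₂, Nat.cast_add, t_add_eq_factorial m 2, catalan_eq_factorial,
    cast_choose_of_eq_add (l := m) (by ring),
    show ((m + 1 : ℕ) : ℚ) ^ 2 + 2 * (m + 1 : ℕ) = (m + 1) * (m + 3) by push_cast; ring]
  simp only [mul_add, Nat.reduceAdd, Nat.reduceMul, add_assoc, Nat.factorial_succ]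
  push_cast
  field_simp
  ring

theorem s_B₃_eq_catalan (hn : 1 ≤ n) :
    s n ({A₂, A₃} ∪ {B₃}) = catalan (n + 1) + catalan n := by
  obtain ⟨m, rfl⟩ := Nat.exists_eq_add_of_le' hn
  exact s_succ_B₃ m

theorem s_B₄_eq_choose (hn : 1 ≤ n) : s n ({A₂, A₃} ∪ {B₄}) = (2 * n + 1).choose n := by
  obtain ⟨m, rfl⟩ := Nat.exists_eq_add_of_le' hn
  rw [s_succ_B₄, ← Nat.cast_inj (R := ℚ), Nat.cast_add,
    sum_mul_t_of_quadratic (a := 2 * (m + 1)) (b := -1) (c := 0) fun k _ => by push_cast; ring,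
    t_add_eq_factorial m 1, t_add_eq_factorial m 2, catalan_eq_factorial,
    cast_choose_of_eq_add (l := m + 2) (by ring)]
  simp only [mul_add, Nat.reduceAdd, Nat.reduceMul, add_assoc, Nat.factorial_succ]
  push_cast
  field_simp
  ring

theorem s_B₅_eq_choose (hn : 1 ≤ n) :
    (s n ({A₂, A₃} ∪ {B₅}) : ℚ) =
      8 * n * (2 * n + 1) / ((n + 2) * (n + 3)) * (2 * n - 1).choose n
        + 2 / (n + 2) * (2 * n + 2).choose (n + 1) - (2 * n + 1).choose n := by
  obtain ⟨m, rfl⟩ := Nat.exists_eq_add_of_le' hn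
  rw [s_succ_B₅, Nat.cast_add,
    sum_mul_t_of_quadratic (a := 0) (b := 2 * m + 3) (c := -2) fun k hk => by
      push_cast [hk]; ring,
    t_add_eq_factorial m 2, t_add_eq_factorial m 3, catalan_eq_factorial,
    show 2 * (m + 1) - 1 = 2 * m + 1 by omega, cast_choose_of_eq_add (l := m) (by ring),
    cast_choose_of_eq_add (l := m + 2) (by ring), cast_choose_of_eq_add (l := m + 2) (by ring)]
  simp only [mul_add, Nat.reduceAdd, Nat.reduceMul, add_assoc, Nat.factorial_succ]
  push_cast
  field_simp
  ring

theorem s_B₆_eq_choose (hn : 1 ≤ n) :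
    (s n ({A₂, A₃} ∪ {B₆}) : ℚ) =
      3 * (2 * n - 1).choose n * (2 * n + 2).choose 3 / ((n + 2) * (n + 3))
        + (2 * n + 2).choose (n + 1) / (n + 2) := by
  obtain ⟨m, rfl⟩ := Nat.exists_eq_add_of_le' hn
  rw [s_succ_B₆, Nat.cast_add,
    sum_mul_t_of_quadratic (a := (m + 1) * (2 * m + 3)) (b := -(2 * m + 3)) (c := 1) fun k _ => by
      rw [Nat.cast_choose_two]; push_cast; ring,
    t_add_eq_factorial m 1, t_add_eq_factorial m 2, t_add_eq_factorial m 3, catalan_eq_factorial,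
    show 2 * (m + 1) - 1 = 2 * m + 1 by omega, cast_choose_of_eq_add (l := m) (by ring),
    cast_choose_of_eq_add (l := 2 * m + 1) (by ring),
    cast_choose_of_eq_add (l := m + 2) (by ring)]
  simp only [mul_add, Nat.reduceAdd, Nat.reduceMul, add_assoc, Nat.factorial_succ]
  push_cast
  field_simp
  ring

theorem s_B₁_eq_sum (hn : 2 ≤ n) :
    s n ({A₂, A₃} ∪ {B₁}) =
      ∑ k ∈ Icc 1 (n - 1), (n - k + 3).choose 3 * t (n - 2) (k - 1) + catalan (n + 1) := by
  obtain ⟨m, rfl⟩ := Nat.exists_eq_add_of_le' hn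
  rw [s_succ_B₁, sum_Icc_one_eq_sum_range, ← sum_choose_mul_t 3 (n := m) le_rfl,
    sum_range_succ _ (m + 1), t_eq_zero_of_lt m.lt_succ_self, mul_zero, add_zero]
  refine congrArg (· + _) (sum_congr rfl fun k _ => ?_)
  rw [show m + 2 - (k + 1) = m + 1 - k by omega, Nat.add_sub_cancel, Nat.add_sub_cancel]

theorem s_B₂_eq_sum (hn : 2 ≤ n) :
    s n ({A₂, A₃} ∪ {B₂}) =
      ∑ k ∈ Icc 1 (n - 1), (n - k + 2).choose 2 * t (n - 2) (k - 1) + catalan (n + 1) := by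
  obtain ⟨m, rfl⟩ := Nat.exists_eq_add_of_le' hn
  rw [s_succ_B₂, sum_Icc_one_eq_sum_range, ← sum_choose_mul_t 2 (n := m) le_rfl,
    sum_range_succ _ (m + 1), t_eq_zero_of_lt m.lt_succ_self, mul_zero, add_zero]
  refine congrArg (· + _) (sum_congr rfl fun k _ => ?_)
  rw [show m + 2 - (k + 1) = m + 1 - k by omega, Nat.add_sub_cancel, Nat.add_sub_cancel]

theorem s_B₄_eq_sum (hn : 1 ≤ n) :
    s n ({A₂, A₃} ∪ {B₄}) =
      ∑ k ∈ Icc 1 n, (n + k - 1) * t (n - 1) (k - 1) + catalan (n + 1) := by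
  obtain ⟨m, rfl⟩ := Nat.exists_eq_add_of_le' hn
  rw [s_succ_B₄, sum_Icc_one_eq_sum_range]
  simp only [← add_assoc, Nat.add_sub_cancel]

theorem s_B₅_eq_sum (hn : 1 ≤ n) :
    (s n ({A₂, A₃} ∪ {B₅}) : ℤ) =
      ∑ k ∈ Icc 1 n, (((n + k - 1) * (n - k + 2) * t (n - 1) (k - 1) : ℕ) : ℤ)
        - (2 * n + 1).choose n + 2 * catalan (n + 1) := by
  rw [← s_B₄_eq_choose hn]
  obtain ⟨m, rfl⟩ := Nat.exists_eq_add_of_le' hn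
  have hsplit : ∑ k ∈ Icc 1 (m + 1), (m + 1 + k - 1) * (m + 1 - k + 2) * t m (k - 1) =
      ∑ k ∈ range (m + 1), (m + 1 + k) * (m - k + 1) * t m k +
        ∑ k ∈ range (m + 1), (m + 1 + k) * t m k := by
    rw [sum_Icc_one_eq_sum_range, ← sum_add_distrib]
    refine sum_congr rfl fun k _ => ?_
    rw [← add_assoc, Nat.add_sub_cancel, Nat.add_sub_cancel, Nat.add_sub_add_right]
    ring
  rw [← Nat.cast_sum, Nat.add_sub_cancel, hsplit, s_succ_B₄, s_succ_B₅]
  push_cast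
  ring

theorem s_B₆_eq_sum (hn : 1 ≤ n) :
    s n ({A₂, A₃} ∪ {B₆}) =
      ∑ k ∈ Icc 1 n, (n + k).choose 2 * t (n - 1) (k - 1) + catalan (n + 1) := by
  obtain ⟨m, rfl⟩ := Nat.exists_eq_add_of_le' hn
  rw [s_succ_B₆, sum_Icc_one_eq_sum_range]
  simp only [← add_assoc, Nat.add_sub_cancel]

end count

end StandardPuzzle

open StandardPuzzle in
theorem mainTheorem11 (n : ℕ) (hn : 1 ≤ n) :
    -- the closed forms
    ((s n ({A₂, A₃} ∪ {B₁}) : ℚ) = 3 / (n + 3) * (2 * n + 2).choose n ∧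
     (s n ({A₂, A₃} ∪ {B₂}) : ℚ) = (7 * n + 2) / (n ^ 2 + 2 * n) * (2 * n).choose (n + 1) ∧
     s n ({A₂, A₃} ∪ {B₃}) = catalan (n + 1) + catalan n ∧
     s n ({A₂, A₃} ∪ {B₄}) = (2 * n + 1).choose n ∧
     (s n ({A₂, A₃} ∪ {B₅}) : ℚ) =
        8 * n * (2 * n + 1) / ((n + 2) * (n + 3)) * (2 * n - 1).choose n
          + 2 / (n + 2) * (2 * n + 2).choose (n + 1) - (2 * n + 1).choose n ∧
     (s n ({A₂, A₃} ∪ {B₆}) : ℚ) =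
        3 * (2 * n - 1).choose n * (2 * n + 2).choose 3 / ((n + 2) * (n + 3))
          + (2 * n + 2).choose (n + 1) / (n + 2)) ∧
    -- the sums against Catalan's triangle
    ((2 ≤ n → s n ({A₂, A₃} ∪ {B₁}) =
        ∑ k ∈ Finset.Icc 1 (n - 1), (n - k + 3).choose 3 * t (n - 2) (k - 1)
          + catalan (n + 1)) ∧
     (2 ≤ n → s n ({A₂, A₃} ∪ {B₂}) =
        ∑ k ∈ Finset.Icc 1 (n - 1), (n - k + 2).choose 2 * t (n - 2) (k - 1)
          + catalan (n + 1)) ∧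
     s n ({A₂, A₃} ∪ {B₄}) =
        ∑ k ∈ Finset.Icc 1 n, (n + k - 1) * t (n - 1) (k - 1) + catalan (n + 1) ∧
     (s n ({A₂, A₃} ∪ {B₅}) : ℤ) =
        ∑ k ∈ Finset.Icc 1 n, (((n + k - 1) * (n - k + 2) * t (n - 1) (k - 1) : ℕ) : ℤ)
          - (2 * n + 1).choose n + 2 * catalan (n + 1) ∧
     s n ({A₂, A₃} ∪ {B₆}) =
        ∑ k ∈ Finset.Icc 1 n, (n + k).choose 2 * t (n - 1) (k - 1) + catalan (n + 1)) :=
  ⟨⟨s_B₁_eq_choose hn, s_B₂_eq_choose hn, s_B₃_eq_catalan hn, s_B₄_eq_choose hn,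
    s_B₅_eq_choose hn, s_B₆_eq_choose hn⟩,
    s_B₁_eq_sum, s_B₂_eq_sum, s_B₄_eq_sum hn, s_B₅_eq_sum hn, s_B₆_eq_sum hn⟩
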